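/- Let $H$ be a complex Hilbert space, $B$ a bounded selfadjoint operator on $H$ and $S\subseteq H$ a closed subspace. With respect to $H=S\oplus S^\perp$ write $B=\begin{pmatrix} a & b\\ b^* & c\end{pmatrix}$, and let $R(\cdot)$ and $N(\cdot)$ denote range and nullspace. $B$ is called $S$-complementable if $H=S+B^{-1}(S^\perp)$, and $S$-weakly complementable if $R(b)\subseteq R(|a|^{1/2})$; $S$ is called $B$-nonnegative if $\langle Bs,s\rangle\ge 0$ for all $s\in S$. If $B$ is $S$-weakly complementable, its Schur complement to $S$ is $$B_{/S}:=\begin{pmatrix}0&0\\0&c-f^*uf\end{pmatrix},$$ where $a=u|a|$ is the polar decomposition ($u$ a partial isometry with $N(u)=N(a)$) and $f$ is the reduced solution of $b=|a|^{1/2}x$, i.e. the unique bounded $f:S^\perp\to S$ with $b=|a|^{1/2}f$, $N(f)=N(b)$ and $R(f)\subseteq\overline{R(|a|^{1/2})}$. Let $\mathcal P(B,S)$ be the set of bounded operators $Q$ on $H$ with $Q^2=Q$, $R(Q)=S$ and $BQ=Q^*B$. Minima are taken in the order $X\le Y\iff Y-X$ is positive semidefinite. Suppose that $B$ is $S$-weakly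 complementable, and consider the assertion $$B_{/S}=\min\{Q^*BQ : Q \text{ a bounded operator on } H,\ Q^2=Q,\ N(Q)=S\}.\qquad (*)$$ If $B$ is $S$-complementable and $S$ is $B$-nonnegative, then $(*)$ holds. Conversely, if $(*)$ holds and $S\neq H$, then $B$ is $S$-complementable and $S$ is $B$-nonnegative. (Hence, for $S\ne H$, $(*)$ holds if and only if $B$ is $S$-complementable and $S$ is $B$-nonnegative.) Moreover, whenever $(*)$ holds, $B_{/S}=B(I-Q)$ for every $Q\in\mathcal P(B,S)$. -/

import Mathlib

open scoped InnerProductSpace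

namespace SchurComplement

section Douglas

variable {K₁ K₂ H : Type*}
  [NormedAddCommGroup K₁] [InnerProductSpace ℂ K₁] [CompleteSpace K₁]
  [NormedAddCommGroup K₂] [InnerProductSpace ℂ K₂] [CompleteSpace K₂]
  [NormedAddCommGroup H] [InnerProductSpace ℂ H] [CompleteSpace H]

/-- `D` is the reduced solution of the operator equation `Z = Y X`: it solves the equation,
`N(D) = N(Z)`, and `R(D)` is contained in the closure of `R(Y*)`. -/
structure IsReducedSolution (Y : K₁ →L[ℂ] H) (Z : K₂ →L[ℂ] H) (D : K₂ →L[ℂ] K₁) : Prop where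
  eq_comp : Z = Y ∘L D
  ker_eq : D.ker = Z.ker
  range_le : D.range ≤ (ContinuousLinearMap.adjoint Y).range.topologicalClosure

/-- Douglas' lemma: if `R(Z) ⊆ R(Y)`, the reduced solution of `Z = Y X` exists and is unique. -/
theorem existsUnique_isReducedSolution (Y : K₁ →L[ℂ] H) (Z : K₂ →L[ℂ] H)
    (h : Z.range ≤ Y.range) : ∃! D : K₂ →L[ℂ] K₁, IsReducedSolution Y Z D := by
  have hinj : ∀ x ∈ Y.kerᗮ, ∀ y ∈ Y.kerᗮ, Y x = Y y → x = y := by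
    intro x hx y hy hxy
    have h1 : x - y ∈ Y.ker := by simp [hxy]
    have h2 : x - y ∈ Y.kerᗮ := Submodule.sub_mem _ hx hy
    have h3 : ⟪x - y, x - y⟫_ℂ = 0 := (Submodule.mem_orthogonal _ _).1 h2 _ h1
    exact sub_eq_zero.1 (inner_self_eq_zero.1 h3)
  have hex : ∀ z : K₂, ∃ x ∈ Y.kerᗮ, Y x = Z z := by
    intro z
    obtain ⟨x, hx⟩ := h ⟨z, rfl⟩
    have hx : Y x = Z z := hx
    refine ⟨x - Y.ker.starProjection x, Submodule.sub_starProjection_mem_orthogonal x, ?_⟩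
    have h0 : Y (Y.ker.starProjection x) = 0 := Submodule.starProjection_apply_mem Y.ker x
    rw [map_sub, h0, sub_zero, hx]
  choose d hd hYd using hex
  let D : K₂ →ₗ[ℂ] K₁ :=
    { toFun := d
      map_add' := fun x y => hinj _ (hd _) _ (Submodule.add_mem _ (hd x) (hd y)) (by simp [hYd])
      map_smul' := fun c x => hinj _ (hd _) _ (Submodule.smul_mem _ c (hd x)) (by simp [hYd]) }
  have hDc : Continuous D := by
    refine D.continuous_of_seq_closed_graph fun u x y hu hDu => ?_
    refine (hinj _ ((Submodule.isClosed_orthogonal _).mem_of_tendsto hDu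
      (Filter.Eventually.of_forall fun n => hd (u n))) _ (hd x) ?_)
    have h1 : Filter.Tendsto (fun n => Y (d (u n))) Filter.atTop (nhds (Y y)) :=
      (Y.continuous.tendsto y).comp hDu
    have h2 : Filter.Tendsto (fun n => Y (d (u n))) Filter.atTop (nhds (Z x)) := by
      simp only [hYd]
      exact (Z.continuous.tendsto x).comp hu
    exact (tendsto_nhds_unique h1 h2).trans (hYd x).symm
  refine ⟨⟨D, hDc⟩, ⟨?_, ?_, ?_⟩, ?_⟩
  · ext z
    exact (hYd z).symm
  · ext z
    change d z = 0 ↔ Z z = 0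
    constructor
    · intro hz
      rw [← hYd, hz, map_zero]
    · intro hz
      exact hinj _ (hd z) _ (Submodule.zero_mem _) (by rw [hYd, hz, map_zero])
  · rw [← ContinuousLinearMap.orthogonal_ker]
    rintro _ ⟨z, rfl⟩
    exact hd z
  · intro D' hD'
    ext z
    have hr := hD'.range_le
    rw [← ContinuousLinearMap.orthogonal_ker] at hr
    refine hinj _ (hr ⟨z, rfl⟩) _ (hd z) ?_
    exact (DFunLike.congr_fun hD'.eq_comp z).symm.trans (hYd z).symm

/-- The reduced solution of `Z = Y X`, defined when `R(Z) ⊆ R(Y)`. -/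
noncomputable def reducedSolution (Y : K₁ →L[ℂ] H) (Z : K₂ →L[ℂ] H)
    (h : Z.range ≤ Y.range) : K₂ →L[ℂ] K₁ :=
  (existsUnique_isReducedSolution Y Z h).choose

theorem reducedSolution_spec (Y : K₁ →L[ℂ] H) (Z : K₂ →L[ℂ] H) (h : Z.range ≤ Y.range) :
    IsReducedSolution Y Z (reducedSolution Y Z h) :=
  (existsUnique_isReducedSolution Y Z h).choose_spec.1

end Douglas

section Polar

variable {E : Type*} [NormedAddCommGroup E] [InnerProductSpace ℂ E] [CompleteSpace E]

/-- `U` is the partial isometry of the polar decomposition `T = U |T|`, normalized by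
`N(U) = N(T)`. -/
structure IsPolarFactor (T U : E →L[ℂ] E) : Prop where
  norm_map : ∀ x ∈ U.kerᗮ, ‖U x‖ = ‖x‖
  ker_eq : U.ker = T.ker
  eq_mul : T = U * CFC.abs T

theorem norm_abs_apply (T : E →L[ℂ] E) (x : E) : ‖CFC.abs T x‖ = ‖T x‖ := by
  have h0 : star (CFC.abs T) = CFC.abs T := (CFC.abs_nonneg T).isSelfAdjoint.star_eq
  have h1 : star (CFC.abs T) * CFC.abs T = star T * T := by rw [h0, CFC.abs_mul_abs]
  have h2 : ∀ A : E →L[ℂ] E, ⟪A x, A x⟫_ℂ = ⟪(star A * A) x, x⟫_ℂ := fun A =>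
    (ContinuousLinearMap.adjoint_inner_left A x (A x)).symm
  have h3 : ⟪CFC.abs T x, CFC.abs T x⟫_ℂ = ⟪T x, T x⟫_ℂ := by rw [h2, h2, h1]
  rw [inner_self_eq_norm_sq_to_K, inner_self_eq_norm_sq_to_K] at h3
  have h4 : ‖CFC.abs T x‖ ^ 2 = ‖T x‖ ^ 2 := by exact_mod_cast h3
  exact (sq_eq_sq₀ (norm_nonneg _) (norm_nonneg _)).1 h4

/-- The polar decomposition exists and is unique. -/
theorem existsUnique_isPolarFactor (T : E →L[ℂ] E) : ∃! U : E →L[ℂ] E, IsPolarFactor T U := by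
  set A := CFC.abs T with hA
  have hAs : ContinuousLinearMap.adjoint A = A := (CFC.abs_nonneg T).isSelfAdjoint.star_eq
  have hn : ∀ x, ‖A x‖ = ‖T x‖ := norm_abs_apply T
  have hker : A.ker = T.ker := by
    ext x
    change A x = 0 ↔ T x = 0
    rw [← norm_eq_zero, hn, norm_eq_zero]
  set K := A.range.topologicalClosure with hK
  have hKker : K = T.kerᗮ := by
    rw [← hker, ContinuousLinearMap.orthogonal_ker, hAs]
  have : CompleteSpace K := (Submodule.isClosed_topologicalClosure _).completeSpace_coe
  let e : E →ₗ[ℂ] K :=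
    A.toLinearMap.codRestrict K fun x => Submodule.le_topologicalClosure _ ⟨x, rfl⟩
  have he : ∀ x, ((e x : K) : E) = A x := fun x => rfl
  have hdense : DenseRange e := by
    intro y
    rw [Topology.IsInducing.subtypeVal.closure_eq_preimage_closure_image]
    have hy : (y : E) ∈ closure (A.range : Set E) := y.2
    refine closure_mono ?_ hy
    rintro _ ⟨x, rfl⟩
    exact ⟨e x, ⟨x, rfl⟩, rfl⟩
  have hbound : ∃ C : ℝ, ∀ x, ‖T.toLinearMap x‖ ≤ C * ‖e x‖ :=
    ⟨1, fun x => by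
      change ‖T x‖ ≤ 1 * ‖A x‖
      rw [one_mul, hn]⟩
  let U₀ : K →L[ℂ] E := T.toLinearMap.extendOfNorm e
  have hU₀ : ∀ x, U₀ (e x) = T x := fun x => LinearMap.extendOfNorm_eq hdense hbound x
  have hU₀n : ∀ y : K, ‖U₀ y‖ = ‖y‖ := by
    intro y
    refine hdense.induction_on (p := fun y => ‖U₀ y‖ = ‖y‖) y
      (isClosed_eq (by fun_prop) (by fun_prop)) fun x => ?_
    rw [hU₀, ← hn]
    rfl
  have hUker : (U₀ ∘L K.orthogonalProjectionOnto).ker = T.ker := by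
    have h1 : (U₀ ∘L K.orthogonalProjectionOnto).ker = Kᗮ := by
      ext x
      change U₀ (K.orthogonalProjectionOnto x) = 0 ↔ _
      rw [← norm_eq_zero, hU₀n, norm_eq_zero, Submodule.orthogonalProjectionOnto_eq_zero_iff]
    rw [h1, hKker]
    exact Submodule.orthogonal_orthogonal _
  have hUmul : T = (U₀ ∘L K.orthogonalProjectionOnto) * A := by
    ext x
    change T x = U₀ (K.orthogonalProjectionOnto (A x))
    rw [← he x, Submodule.orthogonalProjectionOnto_mem_subspace_eq_self, hU₀]
  refine ⟨U₀ ∘L K.orthogonalProjectionOnto, ⟨?_, hUker, hUmul⟩, ?_⟩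
  · intro x hx
    rw [hUker, ← hKker] at hx
    change ‖U₀ (K.orthogonalProjectionOnto x)‖ = ‖x‖
    rw [hU₀n, Submodule.coe_norm, Submodule.coe_orthogonalProjectionOnto_apply,
      Submodule.starProjection_eq_self_iff.2 hx]
  · intro V hV
    have hVker : ∀ x ∈ Kᗮ, V x = 0 := by
      intro x hx
      have h1 : x ∈ T.ker := by
        rw [hKker] at hx
        rwa [Submodule.orthogonal_orthogonal] at hx
      rw [← hV.ker_eq] at h1
      exact h1
    have hVK : ∀ y : K, V y = U₀ y := by
      intro y
      refine hdense.induction_on (p := fun y : K => V y = U₀ y) y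
        (isClosed_eq (by fun_prop) (by fun_prop)) fun x => ?_
      rw [hU₀, he]
      exact (DFunLike.congr_fun hV.eq_mul x).symm
    ext x
    change V x = U₀ (K.orthogonalProjectionOnto x)
    rw [← hVK]
    have h2 : V (x - K.starProjection x) = 0 :=
      hVker _ (Submodule.sub_starProjection_mem_orthogonal x)
    rw [map_sub, sub_eq_zero] at h2
    exact h2

/-- The partial isometry `U` of the polar decomposition `T = U |T|`, `N(U) = N(T)`. -/
noncomputable def polarFactor (T : E →L[ℂ] E) : E →L[ℂ] E :=
  (existsUnique_isPolarFactor T).choose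

theorem polarFactor_spec (T : E →L[ℂ] E) : IsPolarFactor T (polarFactor T) :=
  (existsUnique_isPolarFactor T).choose_spec.1

end Polar

section Schur

variable {H : Type*} [NormedAddCommGroup H] [InnerProductSpace ℂ H] [CompleteSpace H]

/-! Throughout, `S` is a closed subspace of the Hilbert space `H`; closedness is expressed by
completeness of `S`. The blocks of `B` with respect to `H = S ⊕ Sᗮ` are
`a = P_S B|_S`, `b = P_S B|_{Sᗮ}` and `c = P_{Sᗮ} B|_{Sᗮ}`. -/

/-- The block `a : S → S`. -/
noncomputable def blockA (B : H →L[ℂ] H) (S : Submodule ℂ H) [CompleteSpace S] : S →L[ℂ] S :=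
  S.orthogonalProjectionOnto ∘L B ∘L S.subtypeL

/-- The block `b : Sᗮ → S`. -/
noncomputable def blockB (B : H →L[ℂ] H) (S : Submodule ℂ H) [CompleteSpace S] : Sᗮ →L[ℂ] S :=
  S.orthogonalProjectionOnto ∘L B ∘L Sᗮ.subtypeL

/-- The block `c : Sᗮ → Sᗮ`. -/
noncomputable def blockC (B : H →L[ℂ] H) (S : Submodule ℂ H) [CompleteSpace S] : Sᗮ →L[ℂ] Sᗮ :=
  Sᗮ.orthogonalProjectionOnto ∘L B ∘L Sᗮ.subtypeL

/-- `|T|^{1/2}`. -/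
noncomputable def sqrtAbs {E : Type*} [NormedAddCommGroup E] [InnerProductSpace ℂ E]
    [CompleteSpace E] (T : E →L[ℂ] E) : E →L[ℂ] E :=
  CFC.sqrt (CFC.abs T)

/-- `B` is `S`-complementable: `H = S + B⁻¹(Sᗮ)`. -/
def IsComplementable (B : H →L[ℂ] H) (S : Submodule ℂ H) : Prop :=
  S ⊔ Sᗮ.comap B.toLinearMap = ⊤

/-- `B` is `S`-weakly complementable: `R(b) ⊆ R(|a|^{1/2})`. -/
def IsWeaklyComplementable (B : H →L[ℂ] H) (S : Submodule ℂ H) [CompleteSpace S] : Prop :=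
  (blockB B S).range ≤ (sqrtAbs (blockA B S)).range

/-- `S` is `B`-nonnegative: `⟨Bs, s⟩ ≥ 0` for every `s ∈ S`
(the inner product is real when `B` is selfadjoint). -/
def IsNonnegativeOn (B : H →L[ℂ] H) (S : Submodule ℂ H) : Prop :=
  ∀ s ∈ S, 0 ≤ (⟪B s, s⟫_ℂ).re

/-- The Schur complement `B_{/S}`: the operator with blocks `0, 0, 0, c - f* u f`, where `f` is
the reduced solution of `b = |a|^{1/2} x` and `a = u |a|` is the polar decomposition. -/
noncomputable def schurComplement (B : H →L[ℂ] H) (S : Submodule ℂ H) [CompleteSpace S]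
    (h : IsWeaklyComplementable B S) : H →L[ℂ] H :=
  let f : Sᗮ →L[ℂ] S := reducedSolution (sqrtAbs (blockA B S)) (blockB B S) h
  let u : S →L[ℂ] S := polarFactor (blockA B S)
  Sᗮ.subtypeL ∘L (blockC B S - ContinuousLinearMap.adjoint f ∘L u ∘L f) ∘L
    Sᗮ.orthogonalProjectionOnto

/-- The set `{Q* B Q : Q² = Q, N(Q) = S}`. -/
def projectionCompressions (B : H →L[ℂ] H) (S : Submodule ℂ H) : Set (H →L[ℂ] H) :=
  {X | ∃ Q : H →L[ℂ] H, IsIdempotentElem Q ∧ Q.ker = S ∧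
    X = ContinuousLinearMap.adjoint Q * B * Q}

/-- The set of `B`-selfadjoint projections onto `S`: `Q² = Q`, `R(Q) = S` and `B Q = Q* B`. -/
def selfadjointProjections (B : H →L[ℂ] H) (S : Submodule ℂ H) : Set (H →L[ℂ] H) :=
  {Q | IsIdempotentElem Q ∧ Q.range = S ∧ B * Q = ContinuousLinearMap.adjoint Q * B}

end Schur

end SchurComplement

namespace SchurComplement

open ContinuousLinearMap

/-! ### Minimizing `⟪B x, x⟫` over the cosets of `S` -/

section Compressions

variable {H : Type*} [NormedAddCommGroup H] [InnerProductSpace ℂ H]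

/-! A projection `Q` with nullspace `S` chooses in each coset `h + S` the point `Q h`, and the form
of `Q* B Q` at `h` is `⟪B (Q h), Q h⟫`. A least compression thus minimizes the form of `B` on all
cosets at once. Since the form at `v + s` is `⟪B v, v⟫ + 2 Re ⟪B v, s⟫ + ⟪B s, s⟫`, a projection `E`
is minimal when `S` is `B`-nonnegative and `R(BE) ⊆ Sᗮ`. For `S ≠ H` this is also necessary, by
rank-one perturbations of `E`, and `h = (h - E h) + E h` then gives complementability.

Conversely, complementability gives `R(b) ⊆ R(a)`, hence by Douglas `b = a g`, and the projection
`E` along `S` onto the graph of `-g` satisfies `R(BE) ⊆ Sᗮ`. As `a ≥ 0`, `u` fixes `R(f)` and `f =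
a^{1/2} g`, so `f* u f = g* b` and the Schur complement is `E* B E`.

If `Q` is a `B`-selfadjoint projection onto `S`, then `1 - Q` is another such `E`, and least
elements are unique. -/

theorem sub_apply_mem_of_ker_eq {S : Submodule ℂ H} {Q : H →L[ℂ] H}
    (hQ : IsIdempotentElem Q) (hk : Q.ker = S) (h : H) : h - Q h ∈ S := by
  rw [← hk]
  change Q (h - Q h) = 0
  have h1 : Q (Q h) = Q h := DFunLike.congr_fun hQ.eq h
  rw [map_sub, h1, sub_self]

theorem apply_sub_apply_mem_of_ker_eq {S : Submodule ℂ H} {Q E : H →L[ℂ] H}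
    (hQ : IsIdempotentElem Q) (hQk : Q.ker = S) (hE : IsIdempotentElem E) (hEk : E.ker = S)
    (h : H) : Q h - E h ∈ S := by
  have h1 := S.sub_mem (sub_apply_mem_of_ker_eq hE hEk h) (sub_apply_mem_of_ker_eq hQ hQk h)
  rwa [sub_sub_sub_cancel_left] at h1

/-- If `t² p + 2 t q ≥ 0` for all real `t`, then `p ≥ 0` and `q = 0`. -/
theorem nonneg_and_eq_zero_of_forall_quadratic {p q : ℝ}
    (h : ∀ t : ℝ, 0 ≤ t ^ 2 * p + 2 * t * q) : 0 ≤ p ∧ q = 0 := by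
  have hp : 0 ≤ p := by linarith [h 1, h (-1)]
  refine ⟨hp, ?_⟩
  -- The minimizer would be `-q / p`; the shift to `p + 1` avoids dividing by zero and still gives a
  -- negative value when `q ≠ 0`.
  have h1 := h (-q / (p + 1))
  have h2 : (-q / (p + 1)) ^ 2 * p + 2 * (-q / (p + 1)) * q = -(q ^ 2 * (p + 2) / (p + 1) ^ 2) := by
    field_simp
    ring
  rw [h2, neg_nonneg] at h1
  by_contra hq
  have : 0 < q ^ 2 * (p + 2) / (p + 1) ^ 2 := by positivity
  linarith

theorem isComplementable_of_apply_mem_orthogonal {B : H →L[ℂ] H} {S : Submodule ℂ H}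
    {E : H →L[ℂ] H} (hE : IsIdempotentElem E) (hEk : E.ker = S) (hBE : ∀ h, B (E h) ∈ Sᗮ) :
    IsComplementable B S := by
  refine eq_top_iff.2 fun h _ => ?_
  rw [← sub_add_cancel h (E h)]
  exact Submodule.add_mem_sup (sub_apply_mem_of_ker_eq hE hEk h) (hBE h)

variable [CompleteSpace H]

theorem re_inner_apply_add_smul {B : H →L[ℂ] H} (hB : IsSelfAdjoint B) (v s : H) (t : ℝ) :
    (⟪B (v + (t : ℂ) • s), v + (t : ℂ) • s⟫_ℂ).re =
      (⟪B v, v⟫_ℂ).re + (t ^ 2 * (⟪B s, s⟫_ℂ).re + 2 * t * (⟪B v, s⟫_ℂ).re) := by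
  have h1 : ⟪B s, v⟫_ℂ = starRingEnd ℂ ⟪B v, s⟫_ℂ := by
    rw [inner_conj_symm]
    exact hB.isSymmetric s v
  simp only [map_add, map_smul, inner_add_left, inner_add_right, inner_smul_left,
    inner_smul_right, h1, Complex.conj_ofReal, Complex.add_re, Complex.re_ofReal_mul,
    Complex.conj_re]
  ring

theorem le_iff_forall_re_inner {X Y : H →L[ℂ] H} (hX : IsSelfAdjoint X) (hY : IsSelfAdjoint Y) :
    X ≤ Y ↔ ∀ h, (⟪X h, h⟫_ℂ).re ≤ (⟪Y h, h⟫_ℂ).re := by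
  rw [ContinuousLinearMap.le_def, ContinuousLinearMap.isPositive_def']
  constructor
  · rintro ⟨-, h⟩ x
    have := h x
    rw [ContinuousLinearMap.reApplyInnerSelf_apply, sub_apply, inner_sub_left] at this
    simpa using this
  · intro h
    refine ⟨hY.sub hX, fun x => ?_⟩
    rw [ContinuousLinearMap.reApplyInnerSelf_apply, sub_apply, inner_sub_left]
    simpa using h x

theorem isSelfAdjoint_compression {B : H →L[ℂ] H} (hB : IsSelfAdjoint B) (Q : H →L[ℂ] H) :
    IsSelfAdjoint (adjoint Q * B * Q) :=
  hB.conjugate' Q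

/-- Moves the adjoints across the inner product, so that the operator order becomes a comparison of
the form of `B` at two points. -/
theorem compression_le_compression_iff {B : H →L[ℂ] H} (hB : IsSelfAdjoint B)
    (E Q : H →L[ℂ] H) : adjoint E * B * E ≤ adjoint Q * B * Q ↔
      ∀ h, (⟪B (E h), E h⟫_ℂ).re ≤ (⟪B (Q h), Q h⟫_ℂ).re := by
  rw [le_iff_forall_re_inner (isSelfAdjoint_compression hB E) (isSelfAdjoint_compression hB Q)]
  have key : ∀ (A : H →L[ℂ] H) (h : H), ⟪(adjoint A * B * A) h, h⟫_ℂ = ⟪B (A h), A h⟫_ℂ :=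
    fun A h => adjoint_inner_left A h (B (A h))
  simp only [key]

/-- A projection `E` with nullspace `S` and `R(BE) ⊆ Sᗮ` minimizes the compressions of `B` when
`S` is `B`-nonnegative. -/
theorem isLeast_compression {B : H →L[ℂ] H} (hB : IsSelfAdjoint B) {S : Submodule ℂ H}
    (hS : IsNonnegativeOn B S) {E : H →L[ℂ] H} (hE : IsIdempotentElem E) (hEk : E.ker = S)
    (hBE : ∀ h, B (E h) ∈ Sᗮ) :
    IsLeast (projectionCompressions B S) (adjoint E * B * E) := by
  refine ⟨⟨E, hE, hEk, rfl⟩, ?_⟩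
  rintro _ ⟨Q, hQ, hQk, rfl⟩
  rw [compression_le_compression_iff hB]
  intro h
  have hs := apply_sub_apply_mem_of_ker_eq hQ hQk hE hEk h
  have h1 := re_inner_apply_add_smul hB (E h) (Q h - E h) 1
  rw [Submodule.inner_left_of_mem_orthogonal hs (hBE h)] at h1
  simp only [Complex.ofReal_one, one_smul, add_sub_cancel, Complex.zero_re] at h1
  linarith [hS _ hs]

/-- If the compression by `E` is least and `S` is proper, then `S` is `B`-nonnegative and
`R(BE) ⊆ Sᗮ`. -/
theorem nonnegativeOn_and_apply_mem_orthogonal {B : H →L[ℂ] H} (hB : IsSelfAdjoint B)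
    {S : Submodule ℂ H} [CompleteSpace S] (hne : S ≠ ⊤) {E : H →L[ℂ] H}
    (hE : IsIdempotentElem E) (hEk : E.ker = S)
    (hmin : adjoint E * B * E ∈ lowerBounds (projectionCompressions B S)) :
    IsNonnegativeOn B S ∧ ∀ h, B (E h) ∈ Sᗮ := by
  have key : ∀ s ∈ S, ∀ y ∈ Sᗮ, y ≠ 0 →
      0 ≤ (⟪B s, s⟫_ℂ).re ∧ (⟪B (E y), s⟫_ℂ).re = 0 := by
    intro s hs y hy hy0
    refine nonneg_and_eq_zero_of_forall_quadratic fun t => ?_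
    -- Rank-one operator that kills `S`, maps into `S` and sends `y` to `t • s`. Hence `E + L` is
    -- again a projection with nullspace `S`, moving `E y` by `t • s`.
    let L : H →L[ℂ] H := (innerSL ℂ y).smulRight (((t : ℂ) / ⟪y, y⟫_ℂ) • s)
    have hL : ∀ h, L h = ⟪y, h⟫_ℂ • ((t : ℂ) / ⟪y, y⟫_ℂ) • s := fun h => rfl
    have hLS : ∀ h ∈ S, L h = 0 := fun h hh => by
      rw [hL, Submodule.inner_left_of_mem_orthogonal hh hy, zero_smul]
    have hLm : ∀ h, L h ∈ S := fun h => by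
      rw [hL]
      exact S.smul_mem _ (S.smul_mem _ hs)
    have hES : ∀ h ∈ S, E h = 0 := fun h hh => by
      rw [← hEk] at hh
      exact hh
    have hLE : ∀ h, L (E h) = L h := fun h => by
      have h1 := hLS _ (sub_apply_mem_of_ker_eq hE hEk h)
      rw [map_sub, sub_eq_zero] at h1
      exact h1.symm
    have hEE : ∀ h, E (E h) = E h := fun h => DFunLike.congr_fun hE.eq h
    have hQi : IsIdempotentElem (E + L) := by
      ext h
      change E (E h + L h) + L (E h + L h) = E h + L h
      rw [map_add, map_add, hEE, hES _ (hLm h), hLE, hLS _ (hLm h), add_zero, add_zero]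
    have hQk : (E + L).ker = S := by
      ext h
      change E h + L h = 0 ↔ h ∈ S
      refine ⟨fun h0 => ?_, fun hh => by rw [hES h hh, hLS h hh, add_zero]⟩
      have h1 : E (E h + L h) = 0 := by rw [h0, map_zero]
      rw [map_add, hEE, hES _ (hLm h), add_zero] at h1
      rw [← hEk]
      exact h1
    have h1 := (compression_le_compression_iff hB E (E + L)).1 (hmin ⟨E + L, hQi, hQk, rfl⟩) y
    have h2 : (E + L) y = E y + (t : ℂ) • s := by
      rw [add_apply, hL, smul_smul, mul_div_cancel₀ _ (inner_self_ne_zero.2 hy0)]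
    rw [h2, re_inner_apply_add_smul hB] at h1
    linarith
  constructor
  · intro s hs
    have hne' : Sᗮ ≠ ⊥ := fun h => hne ((Submodule.orthogonal_eq_bot_iff).1 h)
    obtain ⟨y, hy, hy0⟩ := Submodule.exists_mem_ne_zero_of_ne_bot hne'
    exact (key s hs y hy hy0).1
  · intro h
    have hy : E h = E (h - S.starProjection h) := by
      have h1 : S.starProjection h ∈ E.ker := by
        rw [hEk]
        exact Submodule.starProjection_apply_mem S h
      have h2 : E (S.starProjection h) = 0 := h1
      rw [map_sub, h2, sub_zero]
    have hym := Submodule.sub_starProjection_mem_orthogonal (K := S) h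
    rw [hy]
    by_cases hy0 : h - S.starProjection h = 0
    · rw [hy0, map_zero, map_zero]
      exact Submodule.zero_mem _
    rw [Submodule.mem_orthogonal']
    intro s hs
    apply Complex.ext
    · exact (key s hs _ hym hy0).2
    -- Rotating `s` by `i` turns the imaginary part into a real part.
    · have h1 := (key (Complex.I • s) (S.smul_mem _ hs) _ hym hy0).2
      rw [inner_smul_right] at h1
      simpa using h1

/-- The operator `B (1 - Q)` is the compression by `1 - Q`, which annihilates `S`. -/
theorem compression_one_sub {B : H →L[ℂ] H} {S : Submodule ℂ H} {Q : H →L[ℂ] H}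
    (hQ : Q ∈ selfadjointProjections B S) :
    B * (1 - Q) = adjoint (1 - Q) * B * (1 - Q) ∧ (1 - Q).ker = S ∧
      ∀ h, B ((1 - Q) h) ∈ Sᗮ := by
  obtain ⟨hi, hr, hBQ⟩ := hQ
  have hBE : B * (1 - Q) = adjoint (1 - Q) * B := by
    have h1 : adjoint (1 - Q) = 1 - adjoint Q := by
      rw [← star_eq_adjoint, star_sub, star_one]
      rfl
    rw [h1, mul_sub, sub_mul, hBQ, mul_one, one_mul]
  have hQS : ∀ s ∈ S, (1 - Q) s = 0 := by
    intro s hs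
    rw [← hr] at hs
    obtain ⟨x, rfl⟩ := hs
    change Q x - Q (Q x) = 0
    rw [show Q (Q x) = Q x from DFunLike.congr_fun hi.eq x, sub_self]
  refine ⟨?_, ?_, fun h => ?_⟩
  · rw [← hBE, mul_assoc, hi.one_sub.eq]
  · ext s
    refine ⟨fun hs => ?_, hQS s⟩
    have h1 : s - Q s = 0 := hs
    rw [← hr, sub_eq_zero.1 h1]
    exact ⟨s, rfl⟩
  · rw [Submodule.mem_orthogonal']
    intro s hs
    have h1 : B ((1 - Q) h) = adjoint (1 - Q) (B h) := DFunLike.congr_fun hBE h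
    rw [h1, adjoint_inner_left, hQS s hs, inner_zero_right]

end Compressions

/-! ### Reduced solutions and the polar factor for a positive operator -/

section Positive

variable {K E : Type*} [NormedAddCommGroup K] [InnerProductSpace ℂ K]
  [NormedAddCommGroup E] [InnerProductSpace ℂ E] [CompleteSpace E] {T : E →L[ℂ] E}

/-- The polar factor of a positive operator fixes the closure of its range. -/
theorem polarFactor_apply_of_mem_closure (hT : 0 ≤ T) {x : E}
    (hx : x ∈ T.range.topologicalClosure) : polarFactor T x = x := by
  have hcl : IsClosed {x | polarFactor T x = x} := isClosed_eq (by fun_prop) (by fun_prop)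
  refine closure_minimal ?_ hcl hx
  rintro _ ⟨z, rfl⟩
  have h1 := (polarFactor_spec T).eq_mul
  rw [CFC.abs_of_nonneg T hT] at h1
  exact (DFunLike.congr_fun h1 z).symm

theorem sqrtAbs_sqrtAbs_apply (hT : 0 ≤ T) (x : E) : sqrtAbs T (sqrtAbs T x) = T x := by
  have h : sqrtAbs T * sqrtAbs T = T := by
    rw [sqrtAbs, CFC.abs_of_nonneg T hT]
    exact CFC.sqrt_mul_sqrt_self T hT
  exact DFunLike.congr_fun h x

theorem adjoint_sqrtAbs (T : E →L[ℂ] E) : adjoint (sqrtAbs T) = sqrtAbs T :=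
  (CFC.sqrt_nonneg (CFC.abs T)).isSelfAdjoint.star_eq

theorem ker_sqrtAbs (hT : 0 ≤ T) : (sqrtAbs T).ker = T.ker := by
  ext x
  change sqrtAbs T x = 0 ↔ T x = 0
  refine ⟨fun h => by rw [← sqrtAbs_sqrtAbs_apply hT, h, map_zero], fun h => ?_⟩
  have h1 : ⟪sqrtAbs T x, sqrtAbs T x⟫_ℂ = 0 := by
    rw [← adjoint_inner_left, adjoint_sqrtAbs, sqrtAbs_sqrtAbs_apply hT, h, inner_zero_left]
  exact inner_self_eq_zero.1 h1

/-- If `g` is the reduced solution of `Z = T x` with `T ≥ 0`, then `T^{1/2} g` is the reduced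
solution of `Z = T^{1/2} x`. -/
theorem IsReducedSolution.sqrtAbs_comp (hT : 0 ≤ T) {Z g : K →L[ℂ] E}
    (hg : IsReducedSolution T Z g) : IsReducedSolution (sqrtAbs T) Z (sqrtAbs T ∘L g) := by
  have hZ : ∀ y, Z y = T (g y) := fun y => DFunLike.congr_fun hg.eq_comp y
  refine ⟨?_, ?_, ?_⟩
  · ext y
    change Z y = sqrtAbs T (sqrtAbs T (g y))
    rw [sqrtAbs_sqrtAbs_apply hT, hZ]
  · ext y
    change sqrtAbs T (g y) = 0 ↔ Z y = 0
    refine ⟨fun h => by rw [hZ, ← sqrtAbs_sqrtAbs_apply hT, h, map_zero], fun h => ?_⟩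
    have h1 : y ∈ g.ker := by
      rw [hg.ker_eq]
      exact h
    rw [show g y = 0 from h1, map_zero]
  · rw [adjoint_sqrtAbs]
    rintro _ ⟨y, rfl⟩
    exact Submodule.le_topologicalClosure _ ⟨g y, rfl⟩

/-- `T` and `T^{1/2}` have the same nullspace, hence the same closure of range; it contains `R(f)`
and is fixed by the polar factor. So `f* u f = f* f`. -/
theorem IsReducedSolution.polarFactor_apply (hT : 0 ≤ T) {Z f : K →L[ℂ] E}
    (hf : IsReducedSolution (sqrtAbs T) Z f) (y : K) : polarFactor T (f y) = f y := by
  refine polarFactor_apply_of_mem_closure hT ?_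
  have hadj : adjoint T = T := hT.isSelfAdjoint.star_eq
  have h1 := hf.range_le ⟨y, rfl⟩
  rwa [← orthogonal_ker, ker_sqrtAbs hT, orthogonal_ker, hadj] at h1

/-- For reduced solutions `f` of `Z = T^{1/2} x` and `g` of `Z = T x` one has `f* f = g* Z`. -/
theorem IsReducedSolution.inner_apply_apply [CompleteSpace K] (hT : 0 ≤ T) {Z f g : K →L[ℂ] E}
    (hf : IsReducedSolution (sqrtAbs T) Z f) (hg : IsReducedSolution T Z g) (y z : K) :
    ⟪f y, f z⟫_ℂ = ⟪g y, Z z⟫_ℂ := by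
  have hr : Z.range ≤ (sqrtAbs T).range := by
    rw [hf.eq_comp]
    rintro _ ⟨x, rfl⟩
    exact ⟨f x, rfl⟩
  have h1 : f y = sqrtAbs T (g y) := DFunLike.congr_fun
    ((existsUnique_isReducedSolution _ Z hr).unique hf (hg.sqrtAbs_comp hT)) y
  have h2 : Z z = sqrtAbs T (f z) := DFunLike.congr_fun hf.eq_comp z
  rw [h1, ← adjoint_inner_right, adjoint_sqrtAbs, h2]

end Positive

/-! ### The minimizing projection and the Schur complement -/

section Nonnegative

variable {H : Type*} [NormedAddCommGroup H] [InnerProductSpace ℂ H]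
  {B : H →L[ℂ] H} {S : Submodule ℂ H} [CompleteSpace S]

/-- If `y = s + w` with `s ∈ S` and `B w ⊥ S`, then `b y = P_S B y = P_S B s = a s`. -/
theorem range_blockB_le_range_blockA (hc : IsComplementable B S) :
    (blockB B S).range ≤ (blockA B S).range := by
  rintro _ ⟨y, rfl⟩
  have hy : (y : H) ∈ S ⊔ Sᗮ.comap B.toLinearMap := by
    rw [show S ⊔ Sᗮ.comap B.toLinearMap = ⊤ from hc]
    exact Submodule.mem_top
  obtain ⟨s, hs, w, hw, hsw⟩ := Submodule.mem_sup.1 hy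
  refine ⟨⟨s, hs⟩, ?_⟩
  have h0 : S.orthogonalProjectionOnto (B w) = 0 :=
    Submodule.orthogonalProjectionOnto_eq_zero_iff.2 hw
  change S.orthogonalProjectionOnto (B s) = S.orthogonalProjectionOnto (B y)
  rw [← hsw, map_add, map_add, h0, add_zero]

/-- The projection with nullspace `S` whose range is the graph of `-g : Sᗮ → S`. -/
noncomputable def graphProjection (g : Sᗮ →L[ℂ] S) : H →L[ℂ] H :=
  (Sᗮ.subtypeL - S.subtypeL ∘L g) ∘L Sᗮ.orthogonalProjectionOnto

theorem graphProjection_apply (g : Sᗮ →L[ℂ] S) (h : H) :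
    graphProjection g h =
      (Sᗮ.orthogonalProjectionOnto h : H) - (g (Sᗮ.orthogonalProjectionOnto h) : H) :=
  rfl

theorem orthogonalProjectionOnto_orthogonal_eq_zero_iff {h : H} :
    Sᗮ.orthogonalProjectionOnto h = 0 ↔ h ∈ S := by
  rw [Submodule.orthogonalProjectionOnto_eq_zero_iff, Submodule.orthogonal_orthogonal]

theorem orthogonalProjectionOnto_graphProjection (g : Sᗮ →L[ℂ] S) (h : H) :
    Sᗮ.orthogonalProjectionOnto (graphProjection g h) = Sᗮ.orthogonalProjectionOnto h := by
  rw [graphProjection_apply, map_sub, Submodule.orthogonalProjectionOnto_mem_subspace_eq_self,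
    orthogonalProjectionOnto_orthogonal_eq_zero_iff.2 (SetLike.coe_mem _), sub_zero]

theorem isIdempotentElem_graphProjection (g : Sᗮ →L[ℂ] S) :
    IsIdempotentElem (graphProjection g) := by
  ext h
  change graphProjection g (graphProjection g h) = graphProjection g h
  rw [graphProjection_apply g (graphProjection g h), orthogonalProjectionOnto_graphProjection,
    graphProjection_apply]

theorem ker_graphProjection (g : Sᗮ →L[ℂ] S) : (graphProjection g).ker = S := by
  ext h
  change graphProjection g h = 0 ↔ h ∈ S
  rw [← orthogonalProjectionOnto_orthogonal_eq_zero_iff]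
  refine ⟨fun h0 => ?_, fun h0 => ?_⟩
  · rw [← orthogonalProjectionOnto_graphProjection g, h0, map_zero]
  · rw [graphProjection_apply, h0, map_zero, ZeroMemClass.coe_zero, ZeroMemClass.coe_zero,
      sub_zero]

/-- For `y ∈ Sᗮ`, `P_S B (y - g y) = b y - a (g y) = 0`. -/
theorem apply_graphProjection_mem_orthogonal {g : Sᗮ →L[ℂ] S}
    (hg : blockB B S = blockA B S ∘L g) (h : H) : B (graphProjection g h) ∈ Sᗮ := by
  rw [← Submodule.orthogonalProjectionOnto_eq_zero_iff, graphProjection_apply, map_sub, map_sub,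
    sub_eq_zero]
  exact DFunLike.congr_fun hg (Sᗮ.orthogonalProjectionOnto h)

variable [CompleteSpace H]

theorem blockA_nonneg (hB : IsSelfAdjoint B) (hS : IsNonnegativeOn B S) : 0 ≤ blockA B S := by
  have hsymm : IsSelfAdjoint (blockA B S) := by
    rw [isSelfAdjoint_iff_isSymmetric]
    intro x y
    change ⟪S.orthogonalProjectionOnto (B x), y⟫_ℂ = ⟪x, S.orthogonalProjectionOnto (B y)⟫_ℂ
    rw [Submodule.inner_orthogonalProjectionOnto_eq_of_mem_right,
      Submodule.inner_orthogonalProjectionOnto_eq_of_mem_left]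
    exact hB.isSymmetric x y
  rw [le_iff_forall_re_inner (IsSelfAdjoint.zero _) hsymm]
  intro x
  change (⟪(0 : S), x⟫_ℂ).re ≤ (⟪S.orthogonalProjectionOnto (B x), x⟫_ℂ).re
  rw [inner_zero_left, Submodule.inner_orthogonalProjectionOnto_eq_of_mem_right]
  exact hS x x.2

theorem inner_schurComplement (hw : IsWeaklyComplementable B S) {f : Sᗮ →L[ℂ] S}
    (hf : IsReducedSolution (sqrtAbs (blockA B S)) (blockB B S) f) (h k : H) :
    ⟪schurComplement B S hw h, k⟫_ℂ =
      ⟪B (Sᗮ.orthogonalProjectionOnto h), (Sᗮ.orthogonalProjectionOnto k : H)⟫_ℂ -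
        ⟪polarFactor (blockA B S) (f (Sᗮ.orthogonalProjectionOnto h)),
          f (Sᗮ.orthogonalProjectionOnto k)⟫_ℂ := by
  have hf' : reducedSolution (sqrtAbs (blockA B S)) (blockB B S) hw = f :=
    (existsUnique_isReducedSolution _ _ hw).unique (reducedSolution_spec _ _ hw) hf
  have h1 : schurComplement B S hw h = ((blockC B S (Sᗮ.orthogonalProjectionOnto h) -
      adjoint f (polarFactor (blockA B S) (f (Sᗮ.orthogonalProjectionOnto h))) : Sᗮ) : H) := by
    rw [← hf']
    rfl
  rw [h1, ← Submodule.inner_orthogonalProjectionOnto_eq_of_mem_left, inner_sub_left,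
    adjoint_inner_left]
  have h2 : ⟪blockC B S (Sᗮ.orthogonalProjectionOnto h), Sᗮ.orthogonalProjectionOnto k⟫_ℂ =
      ⟪B (Sᗮ.orthogonalProjectionOnto h), (Sᗮ.orthogonalProjectionOnto k : H)⟫_ℂ :=
    Submodule.inner_orthogonalProjectionOnto_eq_of_mem_right (Sᗮ.orthogonalProjectionOnto k)
      (B (Sᗮ.orthogonalProjectionOnto h))
  rw [h2]

/-- If `S` is `B`-nonnegative and `g` is the reduced solution of `b = a x`, the Schur complement
is the compression of `B` by the projection onto the graph of `-g` along `S`. -/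
theorem schurComplement_eq_compression (hB : IsSelfAdjoint B)
    (hw : IsWeaklyComplementable B S) (hS : IsNonnegativeOn B S) {g : Sᗮ →L[ℂ] S}
    (hg : IsReducedSolution (blockA B S) (blockB B S) g) :
    schurComplement B S hw = adjoint (graphProjection g) * B * graphProjection g := by
  have ha := blockA_nonneg hB hS
  have hf := reducedSolution_spec _ _ hw
  refine ContinuousLinearMap.ext fun h => ext_inner_right ℂ fun k => ?_
  have hR : ⟪(adjoint (graphProjection g) * B * graphProjection g) h, k⟫_ℂ =
      ⟪B (graphProjection g h), graphProjection g k⟫_ℂ :=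
    adjoint_inner_left _ _ _
  have hb : ∀ y z : Sᗮ, ⟪g y, blockB B S z⟫_ℂ = ⟪B (g y), (z : H)⟫_ℂ := fun y z =>
    (Submodule.inner_orthogonalProjectionOnto_eq_of_mem_left _ _).trans
      (hB.isSymmetric _ _).symm
  -- The `S`-component of the second argument drops out because `R(BE) ⊆ Sᗮ`; with `y`, `z` the
  -- `Sᗮ`-parts of `h`, `k`, both sides become `⟪B y, z⟫ - ⟪B (g y), z⟫`.
  rw [hR, graphProjection_apply g k, inner_sub_right, Submodule.inner_left_of_mem_orthogonal
    (SetLike.coe_mem _) (apply_graphProjection_mem_orthogonal hg.eq_comp h), sub_zero,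
    graphProjection_apply, map_sub, inner_sub_left, inner_schurComplement hw hf,
    hf.polarFactor_apply ha, hf.inner_apply_apply ha hg, hb]

end Nonnegative

end SchurComplement

/-- Minimality is with respect to the Loewner order on bounded operators. The restriction `S ≠ ⊤`
concerns one implication only: for `S = ⊤` the set of compressions is `{0}` and the Schur
complement is `0`, whatever the sign of `B`. -/
theorem proposition3p9 {H : Type*} [NormedAddCommGroup H] [InnerProductSpace ℂ H]
    [CompleteSpace H] (B : H →L[ℂ] H) (hB : IsSelfAdjoint B)
    (S : Submodule ℂ H) [CompleteSpace S]
    (hw : SchurComplement.IsWeaklyComplementable B S) :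
    (SchurComplement.IsComplementable B S ∧ SchurComplement.IsNonnegativeOn B S →
      IsLeast (SchurComplement.projectionCompressions B S)
        (SchurComplement.schurComplement B S hw)) ∧
    (S ≠ ⊤ →
      IsLeast (SchurComplement.projectionCompressions B S)
        (SchurComplement.schurComplement B S hw) →
      SchurComplement.IsComplementable B S ∧ SchurComplement.IsNonnegativeOn B S) ∧
    (IsLeast (SchurComplement.projectionCompressions B S)
        (SchurComplement.schurComplement B S hw) →
      ∀ Q ∈ SchurComplement.selfadjointProjections B S,
        SchurComplement.schurComplement B S hw = B * (1 - Q)) := by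
  open SchurComplement in
  refine ⟨?_, ?_, ?_⟩
  · rintro ⟨hc, hS⟩
    obtain ⟨g, hg, -⟩ := existsUnique_isReducedSolution (blockA B S) (blockB B S)
      (range_blockB_le_range_blockA hc)
    rw [schurComplement_eq_compression hB hw hS hg]
    exact isLeast_compression hB hS (isIdempotentElem_graphProjection g) (ker_graphProjection g)
      (apply_graphProjection_mem_orthogonal hg.eq_comp)
  · rintro hne ⟨⟨E, hE, hEk, hEq⟩, hmin⟩
    rw [hEq] at hmin
    obtain ⟨hS, hBE⟩ := nonnegativeOn_and_apply_mem_orthogonal hB hne hE hEk hmin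
    exact ⟨isComplementable_of_apply_mem_orthogonal hE hEk hBE, hS⟩
  · intro hl Q hQ
    obtain ⟨hEq, hQk, hBQ⟩ := compression_one_sub hQ
    -- Nonnegativity of `S` is unavailable when `S = H`, but then both sides vanish.
    by_cases hne : S = ⊤
    · have hQ1 : 1 - Q = 0 := by
        ext h
        have h1 : h ∈ (1 - Q).ker := by
          rw [hQk, hne]
          exact Submodule.mem_top
        exact h1
      obtain ⟨E, hE, hEk, hE'⟩ := hl.1
      have hE0 : E = 0 := by
        ext h
        have h1 : h ∈ E.ker := by
          rw [hEk, hne]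
          exact Submodule.mem_top
        exact h1
      rw [hE', hE0, hQ1, mul_zero, mul_zero]
    · obtain ⟨⟨E, hE, hEk, hE'⟩, hmin⟩ := id hl
      rw [hE'] at hmin
      obtain ⟨hS, -⟩ := nonnegativeOn_and_apply_mem_orthogonal hB hne hE hEk hmin
      rw [hEq]
      exact hl.unique (isLeast_compression hB hS hQ.1.one_sub hQk hBQ)
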